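/- Let $n\ge 0$ be an integer and $[n]=\{1,\dots,n\}$. For complex $n\times n$ matrices $A,B$ and $I\subseteq[n]$ let $\phi(A,B)_I$ be the determinant of the $n\times n$ matrix whose $j$-th column is the $j$-th column of $A$ if $j\in I$ and the $j$-th column of $B$ if $j\notin I$. This defines the projective principal minor map $\phi:\mathbb{C}^{n\times n}\times\mathbb{C}^{n\times n}\to\mathbb{C}^{2^n}$, $(A,B)\mapsto(\phi(A,B)_I)_{I\subseteq[n]}$. Let $$\mathcal{V}_n=\bigl\{[\phi(A,B)] : A,B\in\mathbb{C}^{n\times n},\ \phi(A,B)\neq 0\bigr\}\subseteq\mathbb{P}^{2^n-1}$$ be its image in complex projective space with homogeneous coordinates indexed by the subsets of $[n]$. Then $\mathcal{V}_n$ is closed in the Zariski topology of $\mathbb{P}^{2^n-1}$, i.e. it is the common zero set of a set of homogeneous polynomials, and it is irreducible (non-empty and not the union of two proper relatively closed subsets). That is, $\mathcal{V}_n$ is an irreducible projective variety. -/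

import Mathlib

open scoped LinearAlgebra.Projectivization Topology

/-- The zero locus in the projective space of `σ → K` (homogeneous coordinates indexed by `σ`) of a
set of polynomials; it is used only for sets of homogeneous polynomials, for which the vanishing
at a point does not depend on the representative (see `projectiveZeroLocus_mk`). -/
def projectiveZeroLocus {K σ : Type*} [Field K] (S : Set (MvPolynomial σ K)) :
    Set (ℙ K (σ → K)) :=
  {x | ∀ p ∈ S, MvPolynomial.eval x.rep p = 0}

/-- A projective algebraic set: the common zeros of a set of homogeneous polynomials. -/
def IsProjectiveAlgebraicSet {K σ : Type*} [Field K] (Z : Set (ℙ K (σ → K))) : Prop :=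
  ∃ S : Set (MvPolynomial σ K), (∀ p ∈ S, ∃ d : ℕ, p.IsHomogeneous d) ∧ Z = projectiveZeroLocus S

theorem projectiveZeroLocus_mk {K σ : Type*} [Field K] {S : Set (MvPolynomial σ K)}
    (hS : ∀ p ∈ S, ∃ d : ℕ, p.IsHomogeneous d) (v : σ → K) (hv : v ≠ 0) :
    Projectivization.mk K v hv ∈ projectiveZeroLocus S ↔ ∀ p ∈ S, MvPolynomial.eval v p = 0 := by
  obtain ⟨a, ha⟩ := Projectivization.exists_smul_eq_mk_rep K v hv
  refine forall₂_congr fun p hp => ?_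
  obtain ⟨d, hd⟩ := hS p hp
  have key : MvPolynomial.eval (a • v) p = (a : K) ^ d * MvPolynomial.eval v p :=
    by
    rw [MvPolynomial.eval_eq, MvPolynomial.eval_eq, Finset.mul_sum]
    refine Finset.sum_congr rfl fun m hm => ?_
    have hdeg : ∑ i ∈ m.support, m i = d := by
      rw [← hd.degree_eq_sum_deg_support hm]
    have hpow : ∏ i ∈ m.support, (a • v) i ^ m i = (a : K) ^ d * ∏ i ∈ m.support, v i ^ m i := by
      rw [← hdeg, ← Finset.prod_pow_eq_pow_sum, ← Finset.prod_mul_distrib]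
      exact Finset.prod_congr rfl fun i _ => mul_pow _ _ _
    rw [hpow]
    ring
  rw [← ha, key]
  simp

/-- The Zariski topology on projective space: the closed sets are the projective algebraic sets. -/
@[reducible]
def projectiveZariski (K σ : Type*) [Field K] : TopologicalSpace (ℙ K (σ → K)) :=
  TopologicalSpace.ofClosed {Z | IsProjectiveAlgebraicSet Z}
    ⟨{1}, by
      rintro p rfl
      exact ⟨0, MvPolynomial.isHomogeneous_one σ K⟩, by
      ext x
      simp [projectiveZeroLocus]⟩
    (by
      intro A hA
      refine ⟨{p | (∃ d : ℕ, p.IsHomogeneous d) ∧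
        ∃ Z ∈ A, ∀ x ∈ Z, MvPolynomial.eval x.rep p = 0}, fun p hp => hp.1, ?_⟩
      ext x
      constructor
      · rintro hx p ⟨-, Z, hZ, h⟩
        exact h x (hx Z hZ)
      · intro hx Z hZ
        obtain ⟨S, hS, rfl⟩ := hA hZ
        exact fun p hp => hx p ⟨hS p hp, _, hZ, fun y hy => hy p hp⟩)
    (by
      rintro _ ⟨S, hS, rfl⟩ _ ⟨T, hT, rfl⟩
      refine ⟨{r | ∃ p ∈ S, ∃ q ∈ T, r = p * q}, ?_, ?_⟩
      · rintro _ ⟨p, hp, q, hq, rfl⟩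
        obtain ⟨d, hd⟩ := hS p hp
        obtain ⟨e, he⟩ := hT q hq
        exact ⟨d + e, hd.mul he⟩
      · ext x
        constructor
        · rintro (hx | hx) _ ⟨p, hp, q, hq, rfl⟩
          · simp [hx p hp]
          · simp [hx q hq]
        · intro hx
          by_contra hcon
          simp only [Set.mem_union, not_or, projectiveZeroLocus, Set.mem_ofPred_eq, not_forall]
            at hcon
          obtain ⟨⟨p, hp, hp0⟩, q, hq, hq0⟩ := hcon
          have := hx _ ⟨p, hp, q, hq, rfl⟩
          rw [map_mul, mul_eq_zero] at this
          exact this.elim hp0 hq0)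

/-- The projective principal minor map `φ`. Its coordinate at `I ⊆ [n]` is the maximal minor of the
`n × 2n` matrix `(A, B)` with columns `I` from `A` and columns `[n] \ I` from `B`, each column
standing in its own position, so that for `B = 1` one gets the principal minors of `A`. -/
noncomputable def principalMinorMap (n : ℕ) (A B : Matrix (Fin n) (Fin n) ℂ) :
    Finset (Fin n) → ℂ :=
  fun I => (Matrix.of fun i j => if j ∈ I then A i j else B i j).det

/-- The image `V_n` of the projective principal minor map in `ℙ^(2^n - 1)`, the projective space
with homogeneous coordinates indexed by the subsets of `[n]`. -/
def principalMinorVariety (n : ℕ) : Set (ℙ ℂ (Finset (Fin n) → ℂ)) :=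
  {x | ∃ (A B : Matrix (Fin n) (Fin n) ℂ) (h : principalMinorMap n A B ≠ 0),
    x = Projectivization.mk ℂ (principalMinorMap n A B) h}

/-!
For `B = 1` the coordinate `φ(A, B)_I` is a principal minor of `A`. The key point is that a
polynomial in the entries of `A` that is invariant under conjugation by diagonal matrices is
integral over the algebra generated by the principal minors. To see this, let `v` be a valuation at
which all principal minors have value at most `1`. If some permutation monomial
`∏ j ∈ I, A (σ j) j` has larger value, take such an `I` minimal and then `σ` of maximal value. For
`τ ≠ σ` the multigraph `σ + τ` contains a permutation of a proper non-empty subset of `I`, and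
counting edges in what remains shows that the monomial of `τ` has value at most `1`. So the term of
`σ` dominates the `I`-th minor, which is absurd. Invariant monomials are products of permutation
monomials, hence have value at most `1` as well.

Given a point satisfying all relations between the principal minors, lying over together with the
projection to invariant polynomials and the Nullstellensatz produces a matrix with these principal
minors: the image of `A ↦ φ(A, 1)` is closed. Exchanging the columns of `A` and `B` in a set `T`
translates the coordinates of `φ(A, B)` by `T`, so each affine chart of the projective image reduces
to the chart where the coordinate at `∅` is `1`, in which one may take `B = 1`. Irreducibility holds
because the image is parametrized by polynomials on an affine space.
-/

section PermExponent

variable {ι : Type*}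

/-- The exponent vector of the monomial `∏ j ∈ I, x (σ j) j`; as a multigraph it is the disjoint
union of the cycles of `σ`. -/
noncomputable def permExponent {I : Finset ι} (σ : Equiv.Perm I) : ι × ι →₀ ℕ :=
  ∑ j, Finsupp.single (↑(σ j), ↑j) 1

theorem degree_permExponent {I : Finset ι} (σ : Equiv.Perm I) :
    (permExponent σ).degree = I.card := by
  simp [permExponent]

theorem permExponent_apply_ne_zero_iff {I : Finset ι} {σ : Equiv.Perm I} {p : ι × ι} :
    permExponent σ p ≠ 0 ↔ ∃ j, (↑(σ j), ↑j) = p := by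
  classical
  simp [permExponent, Finsupp.finsetSum_apply, Finsupp.single_apply]

theorem snd_mem_of_permExponent_apply_ne_zero {I : Finset ι} {σ : Equiv.Perm I} {p : ι × ι}
    (h : permExponent σ p ≠ 0) : p.2 ∈ I := by
  obtain ⟨j, rfl⟩ := permExponent_apply_ne_zero_iff.1 h
  exact j.2

theorem permExponent_apply_le_one {I : Finset ι} (σ : Equiv.Perm I) (p : ι × ι) :
    permExponent σ p ≤ 1 := by
  classical
  simp only [permExponent, Finsupp.finsetSum_apply, Finsupp.single_apply, Finset.sum_boole,
    Nat.cast_id, Finset.card_le_one, Finset.mem_filter]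
  rintro a ⟨-, ha⟩ b ⟨-, hb⟩
  exact Subtype.ext (congrArg Prod.snd (ha.trans hb.symm))

theorem permExponent_le_iff {I : Finset ι} {σ : Equiv.Perm I} {d : ι × ι →₀ ℕ} :
    permExponent σ ≤ d ↔ ∀ j, d (↑(σ j), ↑j) ≠ 0 := by
  refine ⟨fun h j => ?_, fun h p => ?_⟩
  · have hσ : permExponent σ (↑(σ j), ↑j) ≠ 0 := permExponent_apply_ne_zero_iff.2 ⟨j, rfl⟩
    exact ((Nat.pos_of_ne_zero hσ).trans_le (h _)).ne'
  · by_cases hp : permExponent σ p = 0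
    · exact hp ▸ Nat.zero_le _
    · obtain ⟨j, rfl⟩ := permExponent_apply_ne_zero_iff.1 hp
      exact (permExponent_apply_le_one σ _).trans (Nat.one_le_iff_ne_zero.2 (h j))

theorem degree_tsub_permExponent {d : ι × ι →₀ ℕ} {J : Finset ι} {σ : Equiv.Perm J}
    (h : permExponent σ ≤ d) : (d - permExponent σ).degree + J.card = d.degree := by
  rw [← degree_permExponent σ, ← map_add, tsub_add_cancel_of_le h]

theorem exists_image_eq_self [DecidableEq ι] {V : Finset ι} (hV : V.Nonempty) {f : ι → ι}
    (hf : Set.MapsTo f V V) : ∃ J ⊆ V, J.Nonempty ∧ J.image f = J := by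
  induction V using Finset.strongInduction with
  | H V ih =>
    have hsub : V.image f ⊆ V := Finset.image_subset_iff.2 hf
    rcases hsub.eq_or_ssubset with h | h
    · exact ⟨V, subset_rfl, hV, h⟩
    · obtain ⟨J, hJ, hne, hJf⟩ := ih (V.image f) h (hV.image f)
        fun j hj => Finset.mem_image_of_mem f (hsub hj)
      exact ⟨J, hJ.trans hsub, hne, hJf⟩

theorem exists_perm_coe_eq_of_image_eq_self [DecidableEq ι] {J : Finset ι} {f : ι → ι}
    (h : J.image f = J) : ∃ σ : Equiv.Perm J, ∀ j, (σ j : ι) = f j := by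
  have hmem (j : J) : f j ∈ J := h.subset (Finset.mem_image_of_mem f j.2)
  have hsurj : Function.Surjective fun j : J => (⟨f j, hmem j⟩ : J) := by
    rintro ⟨i, hi⟩
    obtain ⟨j, hj, rfl⟩ := Finset.mem_image.1 (show i ∈ J.image f by rwa [h])
    exact ⟨⟨j, hj⟩, rfl⟩
  exact ⟨Equiv.ofBijective _ (Finite.surjective_iff_bijective.1 hsurj), fun _ => rfl⟩

theorem exists_perm_forall_rel {r : ι → ι → Prop} {V : Finset ι} (hV : V.Nonempty)
    (h : ∀ j ∈ V, ∃ i ∈ V, r i j) :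
    ∃ J ⊆ V, J.Nonempty ∧ ∃ σ : Equiv.Perm J, ∀ j, r (σ j) j := by
  classical
  have : Nonempty ι := ⟨hV.choose⟩
  choose! f hfV hfr using h
  obtain ⟨J, hJV, hJ, hJf⟩ := exists_image_eq_self hV hfV
  obtain ⟨σ, hσ⟩ := exists_perm_coe_eq_of_image_eq_self hJf
  exact ⟨J, hJV, hJ, σ, fun j => by rw [hσ j]; exact hfr j (hJV j.2)⟩

theorem exists_permExponent_le_add {I : Finset ι} {σ τ : Equiv.Perm I} (h : σ ≠ τ) :
    ∃ J ⊂ I, J.Nonempty ∧ ∃ ρ : Equiv.Perm J, permExponent ρ ≤ permExponent σ + permExponent τ := by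
  classical
  obtain ⟨i, hi⟩ := DFunLike.ne_iff.1 h
  -- Redirecting `σ` at one vertex destroys its injectivity, so the cycles of `g` miss a vertex.
  let g : I → I := Function.update σ i (τ i)
  obtain ⟨J, hJI, hJ, ρ, hρ⟩ := exists_perm_forall_rel (r := fun k j => ∃ a, (↑(g a), ↑a) = (k, j))
    ⟨(i : ι), i.2⟩ fun j hj => ⟨g ⟨j, hj⟩, (g ⟨j, hj⟩).2, ⟨j, hj⟩, rfl⟩
  refine ⟨J, hJI.ssubset_of_ne ?_, hJ, ρ, permExponent_le_iff.2 fun j => ?_⟩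
  · rintro rfl
    have hρg : ⇑ρ = g := by
      ext j
      obtain ⟨a, ha⟩ := hρ j
      obtain rfl : a = j := Subtype.ext (congrArg Prod.snd ha)
      exact (congrArg Prod.fst ha).symm
    have hk : σ.symm (τ i) ≠ i := fun hk => hi (by rw [← hk, Equiv.apply_symm_apply, hk])
    refine hk (ρ.injective ?_)
    rw [hρg]
    simp [g, hk]
  · obtain ⟨a, ha⟩ := hρ j
    rw [← ha, Finsupp.add_apply]
    by_cases hai : a = i
    · have : permExponent τ (↑(g a), ↑a) ≠ 0 :=
        permExponent_apply_ne_zero_iff.2 ⟨a, by simp [g, hai]⟩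
      omega
    · have : permExponent σ (↑(g a), ↑a) ≠ 0 :=
        permExponent_apply_ne_zero_iff.2 ⟨a, by simp [g, hai]⟩
      omega

variable [DecidableEq ι]

/-- The weight of the matrix entry `(i, j)` for conjugation by diagonal matrices, under which it is
multiplied by `dᵢ / dⱼ`. An exponent vector `d` of weight `0` is a multigraph on `ι`, with
`d (i, j)` edges from `j` to `i`, in which every in-degree equals the corresponding out-degree. -/
def conjWeight (p : ι × ι) : ι → ℤ :=
  Pi.single p.1 1 - Pi.single p.2 1

theorem weight_permExponent {I : Finset ι} (σ : Equiv.Perm I) :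
    Finsupp.weight conjWeight (permExponent σ) = 0 := by
  simp only [permExponent, map_sum, Finsupp.weight_single, one_smul, conjWeight,
    Finset.sum_sub_distrib]
  exact sub_eq_zero.2 (Equiv.sum_comp σ fun j : I => (Pi.single (j : ι) 1 : ι → ℤ))

theorem weight_tsub_permExponent {d : ι × ι →₀ ℕ} (hd : Finsupp.weight conjWeight d = 0)
    {J : Finset ι} {σ : Equiv.Perm J} (h : permExponent σ ≤ d) :
    Finsupp.weight conjWeight (d - permExponent σ) = 0 := by
  rwa [← tsub_add_cancel_of_le h, map_add, weight_permExponent, add_zero] at hd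

theorem exists_apply_ne_zero_of_weight_eq_zero {d : ι × ι →₀ ℕ}
    (hd : Finsupp.weight conjWeight d = 0) {i j : ι} (hij : d (i, j) ≠ 0) :
    ∃ k, d (k, i) ≠ 0 := by
  by_contra! hi
  have hterm : ∀ p ∈ d.support, (d p • conjWeight p) i = if p.1 = i then (d p : ℤ) else 0 := by
    intro p hp
    have : i ≠ p.2 := by
      rintro rfl
      exact Finsupp.mem_support_iff.1 hp (hi p.1)
    simp [conjWeight, Pi.single_apply, this, eq_comm]
  have hsum := congrFun hd i
  rw [Finsupp.weight_apply, Finsupp.sum, Finset.sum_apply, Finset.sum_congr rfl hterm,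
    Pi.zero_apply, Finset.sum_eq_zero_iff_of_nonneg fun p _ => by positivity] at hsum
  exact hij (by simpa using hsum (i, j))

theorem exists_permExponent_le_of_weight_eq_zero {d : ι × ι →₀ ℕ}
    (hd : Finsupp.weight conjWeight d = 0) (hne : d ≠ 0) :
    ∃ J : Finset ι, J.Nonempty ∧ ∃ σ : Equiv.Perm J, permExponent σ ≤ d := by
  have hV : (d.support.image Prod.snd).Nonempty := (Finsupp.support_nonempty_iff.2 hne).image _
  have hrel : ∀ j ∈ d.support.image Prod.snd, ∃ i ∈ d.support.image Prod.snd, d (i, j) ≠ 0 := by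
    simp only [Finset.mem_image, Finsupp.mem_support_iff, Prod.exists, exists_eq_right]
    rintro j ⟨i, hij⟩
    exact ⟨i, exists_apply_ne_zero_of_weight_eq_zero hd hij, hij⟩
  obtain ⟨J, -, hJ, σ, hσ⟩ := exists_perm_forall_rel hV hrel
  exact ⟨J, hJ, σ, permExponent_le_iff.2 hσ⟩

@[elab_as_elim]
theorem induction_of_weight_eq_zero {P : (ι × ι →₀ ℕ) → Prop} (zero : P 0)
    (add_permExponent : ∀ d {J : Finset ι} (σ : Equiv.Perm J), Finsupp.weight conjWeight d = 0 →
      P d → P (d + permExponent σ))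
    {d : ι × ι →₀ ℕ} (hd : Finsupp.weight conjWeight d = 0) : P d := by
  induction hN : d.degree using Nat.strong_induction_on generalizing d with
  | _ N ih =>
    by_cases hne : d = 0
    · rwa [hne]
    · obtain ⟨J, hJ, σ, hσ⟩ := exists_permExponent_le_of_weight_eq_zero hd hne
      rw [← tsub_add_cancel_of_le hσ]
      have hd' := weight_tsub_permExponent hd hσ
      refine add_permExponent _ σ hd' (ih _ ?_ hd' rfl)
      have := degree_tsub_permExponent hσ
      have := hJ.card_pos
      omega

end PermExponent

section MonomialEval

variable {α M : Type*} [CommMonoid M]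

/-- The value at `f` of the monomial with exponent vector `d`. It takes values in a monoid, so that
it applies to the valuations of the entries of a matrix. -/
def monomialEval (f : α → M) (d : α →₀ ℕ) : M :=
  d.prod fun a n => f a ^ n

@[simp]
theorem monomialEval_zero (f : α → M) : monomialEval f 0 = 1 :=
  Finsupp.prod_zero_index

theorem monomialEval_add (f : α → M) (d e : α →₀ ℕ) :
    monomialEval f (d + e) = monomialEval f d * monomialEval f e :=
  Finsupp.prod_add_index' (fun _ => pow_zero _) fun _ => pow_add _

theorem monomialEval_permExponent {ι : Type*} (f : ι × ι → M) {I : Finset ι}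
    (σ : Equiv.Perm I) : monomialEval f (permExponent σ) = ∏ j, f (↑(σ j), ↑j) := by
  rw [monomialEval, permExponent,
    ← Finsupp.prod_finsetSum_index (fun _ => pow_zero _) fun _ => pow_add _]
  simp

end MonomialEval

section Valuation

variable {ι Γ : Type*}

theorem forall_add_permExponent_ne_zero_iff {I J : Finset ι} {d : ι × ι →₀ ℕ}
    {ρ : Equiv.Perm J} : (∀ p, (d + permExponent ρ) p ≠ 0 → p.2 ∈ I) ↔
      (∀ p, d p ≠ 0 → p.2 ∈ I) ∧ J ⊆ I := by
  simp only [Finsupp.add_apply, ne_eq, Nat.add_eq_zero_iff, not_and_or, or_imp, forall_and]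
  exact and_congr_right fun _ =>
    ⟨fun h j hj => h (↑(ρ ⟨j, hj⟩), j) (permExponent_apply_ne_zero_iff.2 ⟨⟨j, hj⟩, rfl⟩),
      fun h p hp => h (snd_mem_of_permExponent_apply_ne_zero hp)⟩

theorem monomialEval_le_one_of_degree_lt [DecidableEq ι] [CommMonoid Γ] [Preorder Γ]
    [IsOrderedMonoid Γ] {w : ι × ι → Γ} {I : Finset ι}
    (hI : ∀ J ⊂ I, ∀ ρ : Equiv.Perm J, monomialEval w (permExponent ρ) ≤ 1) {d : ι × ι →₀ ℕ}
    (hd : Finsupp.weight conjWeight d = 0) (hdI : ∀ p, d p ≠ 0 → p.2 ∈ I)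
    (hdeg : d.degree < I.card) : monomialEval w d ≤ 1 := by
  revert hdI hdeg
  refine induction_of_weight_eq_zero (by simp) (fun d J ρ _ ih hdI hdeg => ?_) hd
  obtain ⟨hdI, hJI⟩ := forall_add_permExponent_ne_zero_iff.1 hdI
  rw [map_add, degree_permExponent] at hdeg
  rw [monomialEval_add]
  exact mul_le_one' (ih hdI (by omega)) (hI _ (hJI.ssubset_of_ne (by rintro rfl; omega)) ρ)

theorem monomialEval_le_of_degree_lt [DecidableEq ι] [CommMonoid Γ] [Preorder Γ]
    [IsOrderedMonoid Γ] {w : ι × ι → Γ} {I : Finset ι} {M : Γ} (hM : 1 ≤ M)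
    (hI : ∀ J ⊂ I, ∀ ρ : Equiv.Perm J, monomialEval w (permExponent ρ) ≤ 1)
    (hIM : ∀ ρ : Equiv.Perm I, monomialEval w (permExponent ρ) ≤ M) {d : ι × ι →₀ ℕ}
    (hd : Finsupp.weight conjWeight d = 0) (hdI : ∀ p, d p ≠ 0 → p.2 ∈ I)
    (hdeg : d.degree < 2 * I.card) : monomialEval w d ≤ M := by
  revert hdI hdeg
  refine induction_of_weight_eq_zero (by simp [hM]) (fun d J ρ hd ih hdI hdeg => ?_) hd
  obtain ⟨hdI, hJI⟩ := forall_add_permExponent_ne_zero_iff.1 hdI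
  rw [map_add, degree_permExponent] at hdeg
  rw [monomialEval_add]
  obtain rfl | hJ := hJI.eq_or_ssubset
  · have hd1 := monomialEval_le_one_of_degree_lt hI hd hdI (by omega)
    exact (mul_le_mul' hd1 (hIM ρ)).trans_eq (one_mul M)
  · exact (mul_le_mul' (ih hdI (by omega)) (hI J hJ ρ)).trans_eq (mul_one M)

theorem monomialEval_le_one_of_weight_eq_zero [DecidableEq ι] [CommMonoid Γ] [Preorder Γ]
    [IsOrderedMonoid Γ] {w : ι × ι → Γ}
    (hw : ∀ (I : Finset ι) (σ : Equiv.Perm I), monomialEval w (permExponent σ) ≤ 1)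
    {d : ι × ι →₀ ℕ} (hd : Finsupp.weight conjWeight d = 0) : monomialEval w d ≤ 1 := by
  refine induction_of_weight_eq_zero (by simp) (fun d J σ _ ih => ?_) hd
  rw [monomialEval_add]
  exact mul_le_one' ih (hw J σ)

theorem monomialEval_permExponent_le_one_of_ne [LinearOrderedCommGroupWithZero Γ] {w : ι × ι → Γ}
    {I : Finset ι} (hI : ∀ J ⊂ I, ∀ ρ : Equiv.Perm J, monomialEval w (permExponent ρ) ≤ 1)
    {σ : Equiv.Perm I} (hσ : 1 < monomialEval w (permExponent σ))
    (hmax : ∀ ρ : Equiv.Perm I,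
      monomialEval w (permExponent ρ) ≤ monomialEval w (permExponent σ))
    {τ : Equiv.Perm I} (hτ : σ ≠ τ) :
    monomialEval w (permExponent τ) ≤ 1 := by
  classical
  obtain ⟨J, hJI, hJ, ρ, hρ⟩ := exists_permExponent_le_add hτ
  have hsum := tsub_add_cancel_of_le hρ
  have hdeg := degree_tsub_permExponent hρ
  have hd : Finsupp.weight conjWeight (permExponent σ + permExponent τ - permExponent ρ) = 0 :=
    weight_tsub_permExponent (by simp [weight_permExponent]) hρ
  generalize permExponent σ + permExponent τ - permExponent ρ = d at hsum hdeg hd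
  have hdI : ∀ p, d p ≠ 0 → p.2 ∈ I := by
    refine (forall_add_permExponent_ne_zero_iff (ρ := ρ).1 ?_).1
    rw [hsum, forall_add_permExponent_ne_zero_iff]
    exact ⟨fun p => snd_mem_of_permExponent_apply_ne_zero, subset_rfl⟩
  rw [map_add, degree_permExponent, degree_permExponent] at hdeg
  have hdM := monomialEval_le_of_degree_lt hσ.le hI hmax hd hdI (by have := hJ.card_pos; omega)
  have hprod := congrArg (monomialEval w) hsum
  rw [monomialEval_add, monomialEval_add] at hprod
  refine le_of_mul_le_mul_left ?_ (zero_lt_one.trans hσ)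
  rw [← hprod]
  exact mul_le_mul' hdM (hI J hJI ρ)

end Valuation

section PrincipalMinor

variable {ι R : Type*} [DecidableEq ι] [CommRing R]

/-- The principal minor of `A` with rows and columns in `I`. -/
def principalMinor (A : Matrix ι ι R) (I : Finset ι) : R :=
  (A.submatrix (↑) (↑) : Matrix I I R).det

theorem map_principalMinor {S : Type*} [CommRing S] (f : R →+* S) (A : Matrix ι ι R)
    (I : Finset ι) : f (principalMinor A I) = principalMinor (A.map f) I := by
  rw [principalMinor, RingHom.map_det]
  rfl

theorem principalMinor_eq_sum (A : Matrix ι ι R) (I : Finset ι) :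
    principalMinor A I =
      ∑ σ : Equiv.Perm I, (σ.sign : R) * monomialEval (fun p => A p.1 p.2) (permExponent σ) := by
  simp only [principalMinor, Matrix.det_apply', monomialEval_permExponent, Matrix.submatrix_apply]

end PrincipalMinor

section ValuationBound

variable {ι R Γ : Type*} [CommRing R] [LinearOrderedCommGroupWithZero Γ] (v : Valuation R Γ)

theorem valuation_monomialEval {α : Type*} (f : α → R) (d : α →₀ ℕ) :
    v (monomialEval f d) = monomialEval (fun a => v (f a)) d := by
  simp [monomialEval, Finsupp.prod]

theorem valuation_sign_mul {n : Type*} [Fintype n] [DecidableEq n] (σ : Equiv.Perm n) (x : R) :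
    v ((σ.sign : R) * x) = v x := by
  obtain h | h := Int.units_eq_one_or σ.sign <;> simp [h]

variable {v} in
theorem valuation_monomialEval_permExponent_le_one [DecidableEq ι] {A : Matrix ι ι R}
    (hA : ∀ I, v (principalMinor A I) ≤ 1) (I : Finset ι) (σ : Equiv.Perm I) :
    monomialEval (fun p => v (A p.1 p.2)) (permExponent σ) ≤ 1 := by
  induction I using Finset.strongInduction with
  | H I ih =>
    obtain ⟨τ, hτ⟩ := Finite.exists_max fun τ : Equiv.Perm I =>
      monomialEval (fun p => v (A p.1 p.2)) (permExponent τ)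
    by_contra! hσ
    have hτ1 := hσ.trans_le (hτ σ)
    have hdet : v (principalMinor A I) =
        monomialEval (fun p => v (A p.1 p.2)) (permExponent τ) := by
      rw [principalMinor_eq_sum, v.map_sum_eq_of_lt (Finset.mem_univ τ)]
      · rw [valuation_sign_mul, valuation_monomialEval]
      · intro ρ hρ
        have hne : τ ≠ ρ := by simpa [eq_comm] using hρ
        rw [valuation_sign_mul, valuation_sign_mul, valuation_monomialEval,
          valuation_monomialEval]
        exact (monomialEval_permExponent_le_one_of_ne ih hτ1 hτ hne).trans_lt hτ1
    exact (hdet ▸ hA I).not_gt hτ1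

variable {v} in
theorem valuation_aeval_le_one [DecidableEq ι] {k : Type*} [CommRing k] [Algebra k R]
    (hk : ∀ c : k, v (algebraMap k R c) ≤ 1) {A : Matrix ι ι R}
    (hA : ∀ I, v (principalMinor A I) ≤ 1) {p : MvPolynomial (ι × ι) k}
    (hp : p.IsWeightedHomogeneous conjWeight 0) :
    v (MvPolynomial.aeval (fun a => A a.1 a.2) p) ≤ 1 := by
  rw [MvPolynomial.aeval_def, MvPolynomial.eval₂_eq]
  refine v.map_sum_le fun d hd => ?_
  rw [map_mul]
  refine mul_le_one' (hk _) ((valuation_monomialEval v _ d).trans_le ?_)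
  exact monomialEval_le_one_of_weight_eq_zero (valuation_monomialEval_permExponent_le_one hA)
    (hp (MvPolynomial.mem_support_iff.1 hd))

end ValuationBound

section Integrality

open MvPolynomial

theorem isIntegral_of_forall_valuationSubring {R K : Type*} [CommRing R] [Field K] [Algebra R K]
    {x : K} (h : ∀ V : ValuationSubring K, (∀ r, algebraMap R K r ∈ V) → x ∈ V) :
    IsIntegral R x := by
  by_contra hx
  obtain ⟨V, hV, hxV⟩ := Subring.exists_le_valuationSubring_of_isIntegrallyClosedIn
    (R := (integralClosure R K).toSubring) hx
  exact hxV (h V fun r => hV (algebraMap_mem (integralClosure R K) r))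

variable (ι k : Type*) [DecidableEq ι] [CommRing k]

/-- The principal minors of the generic matrix, whose entries are the variables. -/
noncomputable def genericMinor (I : Finset ι) : MvPolynomial (ι × ι) k :=
  principalMinor (Matrix.mvPolynomialX ι ι k) I

variable {ι k}

theorem isWeightedHomogeneous_genericMinor (I : Finset ι) :
    (genericMinor ι k I).IsWeightedHomogeneous conjWeight 0 := by
  rw [genericMinor, principalMinor_eq_sum]
  refine IsWeightedHomogeneous.sum _ _ _ fun σ _ => ?_
  have hσ := isWeightedHomogeneous_monomial (R := k) conjWeight (permExponent σ)
    ((σ.sign : ℤ) : k) (weight_permExponent σ)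
  rw [monomial_eq] at hσ
  convert hσ using 1
  simp [monomialEval]

theorem eval_genericMinor (A : Matrix ι ι k) (I : Finset ι) :
    eval (fun p => A p.1 p.2) (genericMinor ι k I) = principalMinor A I := by
  rw [genericMinor, map_principalMinor]
  congr 1
  ext i j
  simp

theorem isIntegral_of_isWeightedHomogeneous_conjWeight [IsDomain k] {p : MvPolynomial (ι × ι) k}
    (hp : p.IsWeightedHomogeneous conjWeight 0) :
    IsIntegral (Algebra.adjoin k (Set.range (genericMinor ι k))) p := by
  let K := FractionRing (MvPolynomial (ι × ι) k)
  rw [← isIntegral_algebraMap_iff (IsFractionRing.injective _ K)]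
  refine isIntegral_of_forall_valuationSubring fun V hV => ?_
  let A : Matrix ι ι K := (Matrix.mvPolynomialX ι ι k).map (algebraMap _ K)
  have hA (I) : V.valuation (principalMinor A I) ≤ 1 := by
    rw [← map_principalMinor, V.valuation_le_one_iff]
    exact hV ⟨genericMinor ι k I, Algebra.subset_adjoin ⟨I, rfl⟩⟩
  have hk (c : k) : V.valuation (algebraMap k K c) ≤ 1 :=
    (V.valuation_le_one_iff _).2 (hV (algebraMap k _ c))
  have hAp : aeval (fun a => A a.1 a.2) p = algebraMap _ K p := by
    rw [← aeval_X_left_apply (R := k) p, ← aeval_algebraMap_apply]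
    simp only [aeval_X_left_apply]
    rfl
  rw [← V.valuation_le_one_iff, ← hAp]
  exact valuation_aeval_le_one hk hA hp

end Integrality

section ClosedImage

open MvPolynomial

theorem sum_mul_map_ne_one_of_isIntegral {R A τ : Type*} [CommRing R] [CommRing A] {ψ : R →+* A}
    {I : Ideal R} (hψ : RingHom.ker ψ ≤ I) (hI : I ≠ ⊤) {s : Finset τ} {c : τ → A} {r : τ → R}
    (hc : ∀ t ∈ s, IsIntegral ψ.range (c t)) (hr : ∀ t ∈ s, r t ∈ I) :
    ∑ t ∈ s, c t * ψ (r t) ≠ 1 := by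
  intro hsum
  let S := integralClosure ψ.range A
  let f : R →+* S := (algebraMap ψ.range S).comp ψ.rangeRestrict
  have hf : f.IsIntegral :=
    (RingHom.isIntegral_of_surjective _ ψ.rangeRestrict_surjective).trans _ _
      (algebraMap_isIntegral_iff.2 inferInstance)
  have hker : RingHom.ker f ≤ I := fun x hx => hψ (congrArg Subtype.val hx)
  refine hI ((Ideal.map_eq_top_iff_of_ker_le f hker hf).1 ((Ideal.eq_top_iff_one _).2 ?_))
  have hone : (1 : S) = ∑ t ∈ s.attach, ⟨c t, hc t t.2⟩ * f (r t) := by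
    refine Subtype.ext ?_
    rw [AddSubmonoidClass.coe_finsetSum]
    exact hsum.symm.trans (Finset.sum_attach s fun t => c t * ψ (r t)).symm
  rw [hone]
  exact sum_mem fun t _ => Ideal.mul_mem_left _ _ (Ideal.mem_map_of_mem f (hr t t.2))

theorem exists_forall_eval_eq_zero_of_span_ne_top {σ k : Type*} [Finite σ] [Field k] [IsAlgClosed k]
    {S : Set (MvPolynomial σ k)} (hS : Ideal.span S ≠ ⊤) : ∃ a, ∀ p ∈ S, eval a p = 0 := by
  obtain ⟨m, hm, hle⟩ := Ideal.exists_le_maximal _ hS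
  obtain ⟨a, rfl⟩ := eq_vanishingIdeal_singleton_of_isMaximal k hm
  exact ⟨a, fun p hp => (mem_vanishingIdeal_singleton_iff a p).1 (hle (Ideal.subset_span hp))⟩

theorem weightedHomogeneousComponent_zero_mul_of_isWeightedHomogeneous {R σ M : Type*}
    [CommSemiring R] [AddCommMonoid M] {w : σ → M} {p : MvPolynomial σ R}
    (hp : IsWeightedHomogeneous w p 0) (q : MvPolynomial σ R) :
    weightedHomogeneousComponent w 0 (q * p) = weightedHomogeneousComponent w 0 q * p := by
  classical
  let := weightedGradedAlgebra R w
  simp only [← weightedDecomposition.decompose'_apply]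
  exact DirectSum.coe_decompose_mul_of_right_mem_zero (weightedHomogeneousSubmodule R w) (i := 0)
    (a := q) hp

theorem exists_forall_eval_eq_of_isIntegral {σ τ k M : Type*} [Finite σ] [Field k] [IsAlgClosed k]
    [AddCommMonoid M] {w : σ → M} {g : τ → MvPolynomial σ k}
    (hg : ∀ t, (g t).IsWeightedHomogeneous w 0)
    (hint : ∀ p : MvPolynomial σ k, p.IsWeightedHomogeneous w 0 →
      IsIntegral (Algebra.adjoin k (Set.range g)) p)
    {y : τ → k} (hy : ∀ F, aeval g F = 0 → eval y F = 0) : ∃ a, ∀ t, eval a (g t) = y t := by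
  by_contra! hno
  have htop : Ideal.span (Set.range fun t => g t - C (y t)) = ⊤ := by
    by_contra hne
    obtain ⟨a, ha⟩ := exists_forall_eval_eq_zero_of_span_ne_top hne
    obtain ⟨t, ht⟩ := hno a
    exact ht (by simpa [sub_eq_zero] using ha _ ⟨t, rfl⟩)
  obtain ⟨c, hc⟩ := Finsupp.mem_ideal_span_range_iff_exists_finsupp.1
    ((Ideal.eq_top_iff_one _).1 htop)
  have hw (t : τ) : (g t - C (y t)).IsWeightedHomogeneous w 0 :=
    (hg t).sub (isWeightedHomogeneous_C w _)
  have hone := congrArg (weightedHomogeneousComponent w 0) hc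
  simp only [Finsupp.sum, map_sum,
    weightedHomogeneousComponent_zero_mul_of_isWeightedHomogeneous (hw _),
    (isWeightedHomogeneous_one k w).weightedHomogeneousComponent_same] at hone
  have hker : RingHom.ker (aeval g).toRingHom ≤ RingHom.ker (eval y) := fun F hF => hy F hF
  refine sum_mul_map_ne_one_of_isIntegral hker (RingHom.ker_ne_top _) (s := c.support)
    (c := fun t => weightedHomogeneousComponent w 0 (c t)) (r := fun t => X t - C (y t))
    (fun t _ => ?_) (fun t _ => by simp [RingHom.mem_ker]) ?_
  · have hct := hint _ (weightedHomogeneousComponent_isWeightedHomogeneous 0 (c t))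
    rwa [Algebra.adjoin_range_eq_range_aeval] at hct
  · simpa [algebraMap_eq] using hone

end ClosedImage

section MixedMinor

variable {ι R : Type*} [DecidableEq ι]

/-- The matrix with the columns in `I` taken from `A` and all other columns taken from `B`. -/
def mixColumns (A B : Matrix ι ι R) (I : Finset ι) : Matrix ι ι R :=
  Matrix.of fun i j => if j ∈ I then A i j else B i j

theorem mul_mixColumns [Fintype ι] [NonUnitalNonAssocSemiring R] (P A B : Matrix ι ι R)
    (I : Finset ι) : P * mixColumns A B I = mixColumns (P * A) (P * B) I := by
  ext i j
  by_cases hj : j ∈ I <;> simp [mixColumns, Matrix.mul_apply, hj]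

theorem mixColumns_mixColumns (A B : Matrix ι ι R) (T I : Finset ι) :
    mixColumns (mixColumns B A T) (mixColumns A B T) I = mixColumns A B (symmDiff I T) := by
  ext i j
  by_cases hI : j ∈ I <;> by_cases hT : j ∈ T <;> simp [mixColumns, hI, hT, Finset.mem_symmDiff]

variable [Fintype ι] [CommRing R]

/-- The `I`-th coordinate `φ(A, B)_I` of the projective principal minor map, over any commutative
ring and for any finite index type in place of `[n]`. -/
def mixedMinor (A B : Matrix ι ι R) (I : Finset ι) : R :=
  (mixColumns A B I).det

theorem map_mixedMinor {S : Type*} [CommRing S] (f : R →+* S) (A B : Matrix ι ι R)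
    (I : Finset ι) : f (mixedMinor A B I) = mixedMinor (A.map f) (B.map f) I := by
  rw [mixedMinor, mixedMinor, RingHom.map_det]
  congr 1
  ext i j
  exact apply_ite f _ _ _

theorem mixedMinor_one (A : Matrix ι ι R) (I : Finset ι) :
    mixedMinor A 1 I = principalMinor A I := by
  rw [mixedMinor, ← Matrix.det_transpose, principalMinor, ← Matrix.det_transpose (A.submatrix _ _),
    Matrix.transpose_submatrix, ← Matrix.det_piecewise_one_eq_submatrix_det]
  congr 1
  ext i j
  by_cases hi : i ∈ I <;> simp [mixColumns, Finset.piecewise, hi, Matrix.one_apply, eq_comm]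

theorem mixedMinor_empty (A B : Matrix ι ι R) : mixedMinor A B ∅ = B.det :=
  congrArg Matrix.det (by ext; simp [mixColumns])

theorem mixedMinor_mul_left (P A B : Matrix ι ι R) (I : Finset ι) :
    mixedMinor (P * A) (P * B) I = P.det * mixedMinor A B I := by
  rw [mixedMinor, mixedMinor, ← mul_mixColumns, Matrix.det_mul]

theorem mixedMinor_eq_det_smul {A B : Matrix ι ι R} (hB : IsUnit B.det) :
    mixedMinor A B = B.det • mixedMinor (B⁻¹ * A) 1 := by
  ext I
  rw [Pi.smul_apply, smul_eq_mul, ← mixedMinor_mul_left, mul_one,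
    Matrix.mul_nonsing_inv_cancel_left _ _ hB]

theorem mixedMinor_mixColumns (A B : Matrix ι ι R) (T I : Finset ι) :
    mixedMinor (mixColumns B A T) (mixColumns A B T) I = mixedMinor A B (symmDiff I T) := by
  rw [mixedMinor, mixedMinor, mixColumns_mixColumns]

end MixedMinor

section Polynomial

open MvPolynomial

theorem eval_aeval {R σ τ : Type*} [CommSemiring R] (g : τ → MvPolynomial σ R) (a : σ → R)
    (p : MvPolynomial τ R) : eval a (aeval g p) = eval (fun t => eval a (g t)) p :=
  eval₂Hom_bind₁ _ _ _ _

theorem eval_smul_of_isHomogeneous {R σ : Type*} [CommSemiring R] {p : MvPolynomial σ R} {d : ℕ}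
    (hp : p.IsHomogeneous d) (a : R) (v : σ → R) : eval (a • v) p = a ^ d * eval v p := by
  rw [eval_eq, eval_eq, Finset.mul_sum]
  refine Finset.sum_congr rfl fun m hm => ?_
  have hdeg : ∑ i ∈ m.support, m i = d := by
    rw [← hp.degree_eq_sum_deg_support hm]
  rw [← hdeg, ← Finset.prod_pow_eq_pow_sum, mul_left_comm, ← Finset.prod_mul_distrib]
  exact congrArg _ (Finset.prod_congr rfl fun i _ => mul_pow _ _ _)

theorem exists_isHomogeneous_eval_eq {R σ : Type*} [CommSemiring R] (s : σ)
    (G : MvPolynomial σ R) : ∃ (F : MvPolynomial σ R) (d : ℕ), F.IsHomogeneous d ∧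
      (∀ z, z s = 0 → eval z F = 0) ∧ ∀ z, z s = 1 → eval z F = eval z G := by
  -- One factor `X s` more than homogenizing requires makes `F` vanish where `z s = 0`.
  refine ⟨∑ i ∈ Finset.range (G.totalDegree + 1),
    X s ^ (G.totalDegree + 1 - i) * homogeneousComponent i G, G.totalDegree + 1, ?_, ?_, ?_⟩
  · refine IsHomogeneous.sum _ _ _ fun i hi => ?_
    have hterm := (isHomogeneous_X_pow (R := R) s (G.totalDegree + 1 - i)).mul
      (homogeneousComponent_isHomogeneous i G)
    rwa [Nat.sub_add_cancel (Finset.mem_range.1 hi).le] at hterm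
  · intro z hz
    rw [map_sum]
    refine Finset.sum_eq_zero fun i hi => ?_
    have := Finset.mem_range.1 hi
    rw [map_mul, map_pow, eval_X, hz, zero_pow (by omega), zero_mul]
  · intro z hz
    conv_rhs => rw [← sum_homogeneousComponent G]
    simp [hz]

end Polynomial

section Relations

open MvPolynomial

variable (ι k : Type*) [Fintype ι] [DecidableEq ι] [Field k]

/-- The homogeneous polynomial relations between the mixed minors of pairs of matrices. -/
def homogeneousRelations : Set (MvPolynomial (Finset ι) k) :=
  {F | (∃ d : ℕ, F.IsHomogeneous d) ∧ ∀ A B : Matrix ι ι k, eval (mixedMinor A B) F = 0}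

variable {ι k}

theorem rename_symmDiff_mem_homogeneousRelations {F : MvPolynomial (Finset ι) k}
    (hF : F ∈ homogeneousRelations ι k) (T : Finset ι) :
    rename (fun I => symmDiff I T) F ∈ homogeneousRelations ι k := by
  obtain ⟨⟨d, hd⟩, hF⟩ := hF
  refine ⟨⟨d, hd.rename_isHomogeneous⟩, fun A B => ?_⟩
  rw [eval_rename, ← hF (mixColumns B A T) (mixColumns A B T)]
  exact congrArg (fun z => eval z F) (funext fun I => (mixedMinor_mixColumns A B T I).symm)

theorem exists_mixedMinor_one_eq [IsAlgClosed k] {y : Finset ι → k} (hy : y ∅ = 1)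
    (h : ∀ F ∈ homogeneousRelations ι k, eval y F = 0) :
    ∃ A : Matrix ι ι k, mixedMinor A 1 = y := by
  have hrel (G : MvPolynomial (Finset ι) k) (hG : aeval (genericMinor ι k) G = 0) :
      eval y G = 0 := by
    obtain ⟨F, d, hF, hF0, hF1⟩ := exists_isHomogeneous_eval_eq ∅ G
    rw [← hF1 y hy]
    refine h F ⟨⟨d, hF⟩, fun A B => ?_⟩
    by_cases hB : B.det = 0
    · exact hF0 _ (by rw [mixedMinor_empty, hB])
    · have hzero : eval (mixedMinor (B⁻¹ * A) 1) G = 0 := by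
        have := eval_aeval (genericMinor ι k) (fun p => (B⁻¹ * A) p.1 p.2) G
        simp only [hG, map_zero, eval_genericMinor, ← mixedMinor_one] at this
        exact this.symm
      rw [mixedMinor_eq_det_smul (Ne.isUnit hB), eval_smul_of_isHomogeneous hF,
        hF1 _ (by simp [mixedMinor_empty]), hzero, mul_zero]
  obtain ⟨a, ha⟩ := exists_forall_eval_eq_of_isIntegral isWeightedHomogeneous_genericMinor
    (fun _ => isIntegral_of_isWeightedHomogeneous_conjWeight) hrel
  refine ⟨Matrix.of fun i j => a (i, j), funext fun I => ?_⟩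
  rw [mixedMinor_one, ← eval_genericMinor, ← ha I]
  rfl

theorem exists_mixedMinor_eq_smul [IsAlgClosed k] {y : Finset ι → k} (hy : y ≠ 0)
    (h : ∀ F ∈ homogeneousRelations ι k, eval y F = 0) :
    ∃ (A B : Matrix ι ι k) (c : k), c ≠ 0 ∧ mixedMinor A B = c • y := by
  obtain ⟨T, hT : y T ≠ 0⟩ := Function.ne_iff.1 hy
  have hempty : ((y T)⁻¹ • fun I => y (symmDiff I T)) ∅ = 1 := by
    simp [← Finset.bot_eq_empty, bot_symmDiff, hT]
  obtain ⟨A, hA⟩ := exists_mixedMinor_one_eq hempty fun F hF => by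
    obtain ⟨d, hd⟩ := hF.1
    have hrename := h _ (rename_symmDiff_mem_homogeneousRelations hF T)
    rw [eval_rename] at hrename
    rw [eval_smul_of_isHomogeneous hd]
    exact mul_eq_zero_of_right _ hrename
  refine ⟨mixColumns 1 A T, mixColumns A 1 T, (y T)⁻¹, inv_ne_zero hT, funext fun I => ?_⟩
  rw [mixedMinor_mixColumns, hA]
  simp [symmDiff_symmDiff_cancel_right]

end Relations

section Projective

open MvPolynomial

theorem isClosed_projectiveZariski_iff {K σ : Type*} [Field K] {Z : Set (ℙ K (σ → K))} :
    IsClosed[projectiveZariski K σ] Z ↔ IsProjectiveAlgebraicSet Z := by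
  rw [← @isOpen_compl_iff]
  change IsProjectiveAlgebraicSet Zᶜᶜ ↔ _
  rw [compl_compl]

/-- The image in projective space of the rational map with the given polynomials as homogeneous
coordinates. -/
def projectiveImage {K σ τ : Type*} [Field K] (g : τ → MvPolynomial σ K) : Set (ℙ K (τ → K)) :=
  {x | ∃ (a : σ → K) (h : (fun t => eval a (g t)) ≠ 0), x = Projectivization.mk K _ h}

theorem exists_eval_ne_zero {K σ : Type*} [Field K] [Infinite K] {p : MvPolynomial σ K}
    (hp : p ≠ 0) : ∃ a, eval a p ≠ 0 := by
  by_contra! h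
  exact hp (MvPolynomial.funext fun a => by rw [h a, map_zero])

theorem exists_aeval_ne_zero_of_not_subset {K σ τ : Type*} [Field K] {g : τ → MvPolynomial σ K}
    {S : Set (MvPolynomial τ K)} (hS : ∀ p ∈ S, ∃ d : ℕ, p.IsHomogeneous d)
    (h : ¬projectiveImage g ⊆ projectiveZeroLocus S) : ∃ p ∈ S, aeval g p ≠ 0 := by
  contrapose! h
  rintro _ ⟨a, ha, rfl⟩
  rw [projectiveZeroLocus_mk hS]
  intro p hp
  rw [← eval_aeval, h p hp, map_zero]

theorem isIrreducible_projectiveImage {K σ τ : Type*} [Field K] [Infinite K]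
    {g : τ → MvPolynomial σ K} (hg : g ≠ 0) :
    @IsIrreducible _ (projectiveZariski K τ) (projectiveImage g) := by
  obtain ⟨t, ht : g t ≠ 0⟩ := Function.ne_iff.1 hg
  refine ⟨?_, ?_⟩
  · obtain ⟨a, ha⟩ := exists_eval_ne_zero ht
    exact ⟨_, a, fun h => ha (congrFun h t), rfl⟩
  rw [@isPreirreducible_iff_isClosed_union_isClosed]
  intro Z₁ Z₂ hZ₁ hZ₂ hsub
  obtain ⟨S₁, hS₁, rfl⟩ := isClosed_projectiveZariski_iff.1 hZ₁
  obtain ⟨S₂, hS₂, rfl⟩ := isClosed_projectiveZariski_iff.1 hZ₂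
  by_contra! hcon
  obtain ⟨p₁, hp₁, hne₁⟩ := exists_aeval_ne_zero_of_not_subset hS₁ hcon.1
  obtain ⟨p₂, hp₂, hne₂⟩ := exists_aeval_ne_zero_of_not_subset hS₂ hcon.2
  obtain ⟨a, ha⟩ := exists_eval_ne_zero (mul_ne_zero (mul_ne_zero hne₁ hne₂) ht)
  rw [map_mul, map_mul, eval_aeval, eval_aeval] at ha
  have hne : (fun t => eval a (g t)) ≠ 0 := fun h => right_ne_zero_of_mul ha (congrFun h t)
  rcases hsub ⟨a, hne, rfl⟩ with hmem | hmem
  · rw [projectiveZeroLocus_mk hS₁] at hmem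
    exact left_ne_zero_of_mul (left_ne_zero_of_mul ha) (hmem p₁ hp₁)
  · rw [projectiveZeroLocus_mk hS₂] at hmem
    exact right_ne_zero_of_mul (left_ne_zero_of_mul ha) (hmem p₂ hp₂)

end Projective

section Variety

open MvPolynomial

variable (ι k : Type*) [Fintype ι] [DecidableEq ι] [Field k]

/-- The image of the projective principal minor map over the field `k`, with rows and columns
indexed by `ι`. -/
def mixedMinorVariety : Set (ℙ k (Finset ι → k)) :=
  {x | ∃ (A B : Matrix ι ι k) (h : mixedMinor A B ≠ 0), x = Projectivization.mk k _ h}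

theorem mixedMinorVariety_eq_projectiveZeroLocus [IsAlgClosed k] :
    mixedMinorVariety ι k = projectiveZeroLocus (homogeneousRelations ι k) := by
  have hhom : ∀ F ∈ homogeneousRelations ι k, ∃ d : ℕ, F.IsHomogeneous d := fun F hF => hF.1
  refine Set.Subset.antisymm ?_ fun x hx => ?_
  · rintro _ ⟨A, B, h, rfl⟩
    rw [projectiveZeroLocus_mk hhom]
    exact fun F hF => hF.2 A B
  · induction x using Projectivization.ind with
    | h v hv =>
      rw [projectiveZeroLocus_mk hhom] at hx
      obtain ⟨A, B, c, hc, hAB⟩ := exists_mixedMinor_eq_smul hv hx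
      have hne : mixedMinor A B ≠ 0 := hAB ▸ smul_ne_zero hc hv
      exact ⟨A, B, hne, ((Projectivization.mk_eq_mk_iff' k _ _ hne hv).2 ⟨c, hAB.symm⟩).symm⟩

/-- The mixed minors of a pair of matrices whose entries are independent variables. -/
noncomputable def genericMixedMinor : Finset ι → MvPolynomial (Bool × ι × ι) k :=
  mixedMinor (Matrix.of fun i j => X (true, i, j)) (Matrix.of fun i j => X (false, i, j))

variable {ι k}

theorem eval_genericMixedMinor (a : Bool × ι × ι → k) :
    (fun I => eval a (genericMixedMinor ι k I)) =
      mixedMinor (Matrix.of fun i j => a (true, i, j)) (Matrix.of fun i j => a (false, i, j)) := by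
  ext I
  rw [genericMixedMinor, map_mixedMinor]
  congr 1 <;> ext i j <;> simp

theorem exists_eval_genericMixedMinor_eq (A B : Matrix ι ι k) :
    ∃ a, (fun I => eval a (genericMixedMinor ι k I)) = mixedMinor A B :=
  ⟨fun p => bif p.1 then A p.2.1 p.2.2 else B p.2.1 p.2.2, eval_genericMixedMinor _⟩

variable (ι k)

theorem mixedMinorVariety_eq_projectiveImage :
    mixedMinorVariety ι k = projectiveImage (genericMixedMinor ι k) := by
  ext x
  constructor
  · rintro ⟨A, B, h, rfl⟩
    obtain ⟨a, ha⟩ := exists_eval_genericMixedMinor_eq A B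
    exact ⟨a, ha ▸ h, by simp only [ha]⟩
  · rintro ⟨a, h, rfl⟩
    simp only [eval_genericMixedMinor] at h ⊢
    exact ⟨_, _, h, rfl⟩

theorem genericMixedMinor_ne_zero : genericMixedMinor ι k ≠ 0 := by
  intro hzero
  obtain ⟨a, ha⟩ := exists_eval_genericMixedMinor_eq (0 : Matrix ι ι k) 1
  have hempty := congrFun ha ∅
  rw [mixedMinor_empty, Matrix.det_one, hzero, Pi.zero_apply, map_zero] at hempty
  exact zero_ne_one hempty

theorem mainTheorem5_general [IsAlgClosed k] :
    IsClosed[projectiveZariski k (Finset ι)] (mixedMinorVariety ι k) ∧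
      @IsIrreducible _ (projectiveZariski k (Finset ι)) (mixedMinorVariety ι k) := by
  have : Infinite k := IsAlgClosed.instInfinite
  constructor
  · rw [isClosed_projectiveZariski_iff]
    exact ⟨_, fun F hF => hF.1, mixedMinorVariety_eq_projectiveZeroLocus ι k⟩
  · rw [mixedMinorVariety_eq_projectiveImage]
    exact isIrreducible_projectiveImage (genericMixedMinor_ne_zero ι k)

end Variety

theorem mainTheorem5 (n : ℕ) :
    IsClosed[projectiveZariski ℂ (Finset (Fin n))] (principalMinorVariety n) ∧
      @IsIrreducible _ (projectiveZariski ℂ (Finset (Fin n))) (principalMinorVariety n) :=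
  mainTheorem5_general (Fin n) ℂ
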